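/- Let $m\ge 1$ be an integer and let $F\in\mathbb{C}^{m\times m}$ be the DFT matrix with entries $F_{k,l}=\frac{1}{\sqrt m}e^{-2\pi i kl/m}$, $k,l\in\{1,\dots,m\}$. For $A\subseteq\{1,\dots,m\}$ let $D_A$ be the $m\times m$ diagonal matrix with $(D_A)_{i,i}=1$ for $i\in A$ and $(D_A)_{i,i}=0$ otherwise. For $P,Q\subseteq\{1,\dots,m\}$ let $$\Delta_{P,Q}(F)=\| D_P\,F D_Q F^{H}\|_{2}$$ be the operator norm of $D_P F D_Q F^{H}$ with respect to the Euclidean norm on $\mathbb{C}^m$. For $\lambda\in(0,m]$ define the circular Nyquist density $$\rho(P,\lambda)=\frac1\lambda\max_{r\in[0,m)}\bigl|\widetilde P\cap(r,r+\lambda)\bigr|,\qquad \widetilde P=P\cup\{m+p:p\in P\},$$ where $(r,r+\lambda)$ is the open interval. Let $P\subseteq\{1,\dots,m\}$ be arbitrary, let $l,n\in\{1,\dots,m\}$, and let $Q=\{l+1,\dots,l+n\}$, interpreted circularly in $\{1,\dots,m\}$ (that is, modulo $m$). Then $$\Delta_{P,Q}(F)\le\sqrt{\Bigl(\frac{\lambda(n-1)}{m}+1\Bigr)\rho(P,\lambda)}\qquad\text{for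 all }\lambda\in(0,m].$$ -/

import Mathlib

noncomputable section

namespace LargeSieve

/-- The index set `{1, …, m}`. -/
abbrev Idx (m : ℕ) : Type := ↥(Finset.Icc 1 m)

/-- The `m × m` DFT matrix, with entry `(1/√m) e^{-2πi kl/m}` at `k, l ∈ {1, …, m}`. -/
def dft (m : ℕ) : Matrix (Idx m) (Idx m) ℂ :=
  Matrix.of fun k l =>
    (1 / (Real.sqrt m : ℂ)) *
      Complex.exp (-2 * Real.pi * Complex.I * ((k : ℕ) : ℂ) * ((l : ℕ) : ℂ) / (m : ℂ))

/-- The diagonal matrix `D_A`, with diagonal entry `1` on `A` and `0` off `A`. -/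
def diagProj {m : ℕ} (A : Finset (Idx m)) : Matrix (Idx m) (Idx m) ℂ :=
  Matrix.diagonal fun i => if i ∈ A then 1 else 0

/-- `P_A(U) = U D_A Uᴴ`. -/
def proj {m : ℕ} (A : Finset (Idx m)) (U : Matrix (Idx m) (Idx m) ℂ) :
    Matrix (Idx m) (Idx m) ℂ :=
  U * diagProj A * U.conjTranspose

/-- `Δ_{P,Q}(U)`: the operator norm of `D_P P_Q(U)` on `ℂ^m` with the Euclidean norm. -/
def Delta {m : ℕ} (P Q : Finset (Idx m)) (U : Matrix (Idx m) (Idx m) ℂ) : ℝ :=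
  ‖Matrix.toEuclideanCLM (𝕜 := ℂ) (n := Idx m) (diagProj P * proj Q U)‖

/-- `{l+1, …, l+n}` interpreted circularly in `{1, …, m}`. -/
def circInterval (m l n : ℕ) : Finset (Idx m) :=
  Finset.univ.filter fun i => ∃ k ∈ Finset.Icc 1 n, (i : ℕ) ≡ l + k [MOD m]

/-- `P ∪ {m + p : p ∈ P}`, as a set of natural numbers. -/
def doubled {m : ℕ} (P : Finset (Idx m)) : Finset ℕ :=
  P.image (fun p : Idx m => (p : ℕ)) ∪ P.image (fun p : Idx m => m + (p : ℕ))

/-- The number of points of `P ∪ (m + P)` in the open interval `(r, r + lam)`. -/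
def openCount {m : ℕ} (P : Finset (Idx m)) (lam r : ℝ) : ℕ :=
  ((doubled P).filter fun p : ℕ => r < (p : ℝ) ∧ (p : ℝ) < r + lam).card

/-- The largest value of `openCount P lam r` over `r ∈ [0, m)`. -/
def maxOpenCount {m : ℕ} (P : Finset (Idx m)) (lam : ℝ) : ℕ :=
  sSup (openCount P lam '' Set.Ico (0 : ℝ) m)

/-- The supremum above is a maximum. -/
theorem isGreatest_maxOpenCount {m : ℕ} (hm : 1 ≤ m) (P : Finset (Idx m)) (lam : ℝ) :
    IsGreatest (openCount P lam '' Set.Ico (0 : ℝ) m) (maxOpenCount P lam) := by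
  have hne : (openCount P lam '' Set.Ico (0 : ℝ) m).Nonempty :=
    ⟨_, 0, ⟨le_refl _, by exact_mod_cast hm⟩, rfl⟩
  have hbdd : BddAbove (openCount P lam '' Set.Ico (0 : ℝ) m) := by
    refine ⟨(doubled P).card, ?_⟩
    rintro _ ⟨r, -, rfl⟩
    exact Finset.card_filter_le _ _
  exact ⟨Nat.sSup_mem hne hbdd, fun _ h => le_csSup hbdd h⟩

/-- The circular Nyquist density
`ρ(P, lam) = (1/lam) max_{r ∈ [0,m)} |(P ∪ (m + P)) ∩ (r, r + lam)|`. -/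
def nyquistDensity {m : ℕ} (P : Finset (Idx m)) (lam : ℝ) : ℝ :=
  (1 / lam) * (maxOpenCount P lam : ℝ)

end LargeSieve

end

/-!
Because the DFT matrix is unitary, `Δ` is the norm of its `P × Q` submatrix, which up to the factor
`1 / √m` is the matrix of `n` consecutive frequencies evaluated at the points `p / m`, `p ∈ P`, of
the circle. Bounding that norm is a large sieve inequality.

For `δ`-separated points and `W` consecutive frequencies, summing the geometric series writes the
Gram matrix as `W • 1` plus half a difference, up to a unimodular factor, of two unitary conjugates
of the matrix `1 / sin (π (x i - x j))`. That matrix has norm at most `1 / δ` (Hilbert's inequality,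
after Montgomery and Vaughan): up to a factor `i` it is a Hermitian `H`, and the addition theorem of
the cotangent gives `H * H = M + (C * H - H * C)` with `C` diagonal and `M` of row sums at most
`1 / δ ^ 2`. On an eigenvector of `H` the commutator has zero expectation, so
`‖H‖ ^ 2 ≤ ‖M‖ ≤ 1 / δ ^ 2`.

The points of `P` need not be separated, only sparse: every window of length `λ` contains at most
`N` of them. On the `N`-fold cover of the circle, number the lifted points in order around the
circle and colour each by its number modulo `N`; the total is a multiple of `N`, so this is
consistent around the circle. Two points of the same colour are at least `N` steps apart, so each
of the `N` colour classes is separated by `λ / m`, measured before rescaling the cover, and their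
bounds add up.
-/

namespace LargeSieve

open Finset
open scoped Matrix Matrix.Norms.L2Operator

section OperatorNorm

variable {ι κ τ : Type*} [Fintype ι] [Fintype κ] [DecidableEq κ]

theorem norm_sq_eq_norm_conjTranspose_mul_self (A : Matrix ι κ ℂ) : ‖A‖ ^ 2 = ‖Aᴴ * A‖ := by
  rw [Matrix.l2_opNorm_conjTranspose_mul_self, sq]

theorem norm_submatrix_fst_sq [Fintype τ] (A : Matrix ι κ ℂ) :
    ‖A.submatrix (Prod.fst : ι × τ → ι) id‖ ^ 2 = Fintype.card τ * ‖A‖ ^ 2 := by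
  classical
  have gram : (A.submatrix (Prod.fst : ι × τ → ι) id)ᴴ * A.submatrix (Prod.fst : ι × τ → ι) id =
      Fintype.card τ • (Aᴴ * A) := by
    ext i j
    simp [Matrix.mul_apply, Fintype.sum_prod_type_right]
  rw [norm_sq_eq_norm_conjTranspose_mul_self, gram, ← Nat.cast_smul_eq_nsmul ℝ, norm_smul,
    Real.norm_natCast, norm_sq_eq_norm_conjTranspose_mul_self]

theorem norm_sq_le_sum_norm_submatrix_fiber_sq [Fintype τ] [DecidableEq τ] (A : Matrix ι κ ℂ)
    (c : ι → τ) :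
    ‖A‖ ^ 2 ≤ ∑ j, ‖A.submatrix (Subtype.val : {i // c i = j} → ι) id‖ ^ 2 := by
  have gram : Aᴴ * A = ∑ j, (A.submatrix (Subtype.val : {i // c i = j} → ι) id)ᴴ *
      A.submatrix (Subtype.val : {i // c i = j} → ι) id := by
    ext k l
    simp only [Matrix.mul_apply, Matrix.sum_apply, Matrix.conjTranspose_apply,
      Matrix.submatrix_apply, id]
    exact (Fintype.sum_fiberwise c fun i => star (A i k) * A i l).symm
  simp only [norm_sq_eq_norm_conjTranspose_mul_self]
  rw [gram]
  exact norm_sum_le _ _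

theorem norm_submatrix_coe_id (A : Matrix ι κ ℂ) {P : Finset ι} (hA : ∀ i ∉ P, ∀ k, A i k = 0) :
    ‖A.submatrix (Subtype.val : P → ι) id‖ = ‖A‖ := by
  have gram : (A.submatrix (Subtype.val : P → ι) id)ᴴ * A.submatrix (Subtype.val : P → ι) id =
      Aᴴ * A := by
    ext k l
    simp only [Matrix.mul_apply, Matrix.conjTranspose_apply, Matrix.submatrix_apply, id]
    rw [sum_coe_sort P fun i => star (A i k) * A i l]
    exact sum_subset (subset_univ P) fun i _ hi => by rw [hA i hi l, mul_zero]
  rw [← pow_left_inj₀ (norm_nonneg _) (norm_nonneg _) two_ne_zero,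
    norm_sq_eq_norm_conjTranspose_mul_self, norm_sq_eq_norm_conjTranspose_mul_self, gram]

theorem norm_submatrix_coe_coe (A : Matrix ι κ ℂ) {P : Finset ι} {Q : Finset κ}
    (hP : ∀ i ∉ P, ∀ k, A i k = 0) (hQ : ∀ k ∉ Q, ∀ i, A i k = 0) :
    ‖A.submatrix (Subtype.val : P → ι) (Subtype.val : Q → κ)‖ = ‖A‖ := by
  classical
  have columns : ‖A.submatrix (Subtype.val : P → ι) (Subtype.val : Q → κ)‖ =
      ‖A.submatrix (Subtype.val : P → ι) id‖ := by
    simpa only [Matrix.conjTranspose_submatrix, Matrix.submatrix_submatrix, Function.comp_id,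
      Function.id_comp, ← Matrix.l2_opNorm_conjTranspose (A.submatrix _ _)] using
      norm_submatrix_coe_id (A.submatrix (Subtype.val : P → ι) id)ᴴ (P := Q)
        fun k hk i => by simp [hQ k hk]
  exact columns.trans (norm_submatrix_coe_id A hP)

theorem norm_sq_eq_norm_mul_conjTranspose_self [DecidableEq ι] (A : Matrix ι κ ℂ) :
    ‖A‖ ^ 2 = ‖A * Aᴴ‖ := by
  rw [← Matrix.l2_opNorm_conjTranspose, norm_sq_eq_norm_conjTranspose_mul_self,
    Matrix.conjTranspose_conjTranspose]

theorem norm_one_matrix_le [DecidableEq ι] : ‖(1 : Matrix ι ι ℂ)‖ ≤ 1 := by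
  rw [← Matrix.diagonal_one, Matrix.l2_opNorm_diagonal]
  exact (pi_norm_le_iff_of_nonneg zero_le_one).2 fun _ => norm_one.le

theorem norm_submatrix_id_le {ι' : Type*} [Fintype ι'] (A : Matrix ι κ ℂ) {f : ι' → ι}
    (hf : f.Injective) : ‖A.submatrix f id‖ ≤ ‖A‖ := by
  classical
  let S : Matrix ι' ι ℂ := Matrix.submatrix 1 f id
  have norm_S : ‖S‖ ≤ 1 := by
    have hS : S * Sᴴ = 1 := by
      rw [Matrix.conjTranspose_submatrix, Matrix.conjTranspose_one,
        ← Matrix.submatrix_mul _ _ f id f Function.bijective_id, mul_one, Matrix.submatrix_one f hf]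
    rw [← sq_le_one_iff₀ (norm_nonneg _), norm_sq_eq_norm_mul_conjTranspose_self, hS]
    exact norm_one_matrix_le
  calc ‖A.submatrix f id‖ = ‖S * A‖ :=
        congrArg norm (Matrix.one_submatrix_mul f (Equiv.refl ι) A).symm
    _ ≤ ‖S‖ * ‖A‖ := Matrix.l2_opNorm_mul _ _
    _ ≤ ‖A‖ := mul_le_of_le_one_left (norm_nonneg _) norm_S

theorem norm_submatrix_le {ι' κ' : Type*} [Fintype ι'] [Fintype κ'] [DecidableEq κ']
    (A : Matrix ι κ ℂ) {f : ι' → ι} {g : κ' → κ} (hf : f.Injective) (hg : g.Injective) :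
    ‖A.submatrix f g‖ ≤ ‖A‖ := by
  classical
  have columns : ‖A.submatrix id g‖ ≤ ‖A‖ := by
    simpa only [← Matrix.conjTranspose_submatrix, Matrix.l2_opNorm_conjTranspose] using
      norm_submatrix_id_le Aᴴ hg
  exact (norm_submatrix_id_le (A.submatrix id g) hf).trans columns

variable [DecidableEq ι]

theorem exists_eigenvector_abs_eq_norm [Nonempty ι] {H : Matrix ι ι ℂ} (hH : H.IsHermitian) :
    ∃ (μ : ℝ) (v : ι → ℂ), |μ| = ‖H‖ ∧ v ≠ 0 ∧ H *ᵥ v = (μ : ℂ) • v := by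
  obtain ⟨μ, hμ, hspec⟩ : ∃ μ : ℝ, |μ| = ‖H‖ ∧ μ ∈ spectrum ℝ H := by
    rcases CStarAlgebra.norm_or_neg_norm_mem_spectrum (a := H) hH with h | h
    · exact ⟨_, abs_norm H, h⟩
    · exact ⟨_, by rw [abs_neg, abs_norm], h⟩
  rw [spectrum.mem_iff, Matrix.isUnit_iff_isUnit_det, isUnit_iff_ne_zero, not_not,
    ← Matrix.exists_mulVec_eq_zero_iff] at hspec
  obtain ⟨v, hv, h⟩ := hspec
  refine ⟨μ, v, hμ, hv, ?_⟩
  rw [Matrix.sub_mulVec, sub_eq_zero, Matrix.algebraMap_eq_diagonal] at h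
  rw [← h]
  ext i
  simp [Matrix.mulVec_diagonal]

theorem norm_le_of_sum_norm_le {M : Matrix ι ι ℂ} (hM : M.IsHermitian) {c : ℝ} (hc : 0 ≤ c)
    (hsum : ∀ i, ∑ j, ‖M i j‖ ≤ c) : ‖M‖ ≤ c := by
  cases isEmpty_or_nonempty ι
  · simpa [Subsingleton.elim M 0] using hc
  obtain ⟨μ, v, hμ, hv, hMv⟩ := exists_eigenvector_abs_eq_norm hM
  obtain ⟨i, hi⟩ := Finite.exists_max fun i => ‖v i‖
  have hvi : 0 < ‖v i‖ := by
    obtain ⟨j, hj⟩ := Function.ne_iff.1 hv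
    exact (norm_pos_iff.2 hj).trans_le (hi j)
  refine le_of_mul_le_mul_right ?_ hvi
  calc ‖M‖ * ‖v i‖ = ‖∑ j, M i j * v j‖ := by
        have := congrFun hMv i
        simp only [Matrix.mulVec, dotProduct, Pi.smul_apply, smul_eq_mul] at this
        rw [this, norm_mul, Complex.norm_real, Real.norm_eq_abs, hμ]
    _ ≤ ∑ j, ‖M i j‖ * ‖v i‖ := norm_sum_le_of_le _ fun j _ => by
        rw [norm_mul]
        exact mul_le_mul_of_nonneg_left (hi j) (norm_nonneg _)
    _ ≤ c * ‖v i‖ := by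
        rw [← sum_mul]
        exact mul_le_mul_of_nonneg_right (hsum i) hvi.le

theorem norm_sq_le_of_sq_eq_add_commutator {H M C : Matrix ι ι ℂ} (hH : H.IsHermitian)
    (h : H * H = M + (C * H - H * C)) : ‖H‖ ^ 2 ≤ ‖M‖ := by
  cases isEmpty_or_nonempty ι
  · simp [Subsingleton.elim H 0]
  obtain ⟨μ, v, hμ, hv, hHv⟩ := exists_eigenvector_abs_eq_norm hH
  let V : Matrix ι Unit ℂ := Matrix.replicateCol Unit v
  have hHV : H * V = (μ : ℂ) • V := by
    rw [← Matrix.replicateCol_mulVec, hHv, Matrix.replicateCol_smul]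
  have hVH : Vᴴ * H = (μ : ℂ) • Vᴴ := by
    simpa [hH.eq] using congrArg Matrix.conjTranspose hHV
  have commutator_eq_zero : Vᴴ * (C * H - H * C) * V = 0 := by
    rw [Matrix.mul_sub, Matrix.sub_mul, ← Matrix.mul_assoc, Matrix.mul_assoc _ H V, hHV,
      ← Matrix.mul_assoc, hVH]
    simp
  have compression : (μ : ℂ) ^ 2 • (Vᴴ * V) = Vᴴ * M * V := by
    rw [eq_sub_of_add_eq h.symm, Matrix.mul_sub, Matrix.sub_mul, commutator_eq_zero, sub_zero,
      ← Matrix.mul_assoc, hVH, Matrix.mul_assoc, hHV]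
    rw [Matrix.smul_mul, Matrix.mul_smul, smul_smul, sq]
  have norm_V : 0 < ‖V‖ ^ 2 := by
    refine pow_pos (norm_pos_iff.2 fun h0 => hv ?_) 2
    exact (Matrix.replicateCol_eq_zero v).1 h0
  refine le_of_mul_le_mul_right ?_ norm_V
  calc ‖H‖ ^ 2 * ‖V‖ ^ 2 = ‖Vᴴ * M * V‖ := by
        rw [← compression, norm_smul, norm_pow, Complex.norm_real, Real.norm_eq_abs, hμ,
          norm_sq_eq_norm_conjTranspose_mul_self V]
    _ ≤ ‖Vᴴ‖ * ‖M‖ * ‖V‖ := (Matrix.l2_opNorm_mul _ _).trans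
        (mul_le_mul_of_nonneg_right (Matrix.l2_opNorm_mul _ _) (norm_nonneg _))
    _ = ‖M‖ * ‖V‖ ^ 2 := by rw [Matrix.l2_opNorm_conjTranspose]; ring

end OperatorNorm

section CotangentKernel

variable {ι : Type*} [Fintype ι] [DecidableEq ι] {a b : ι → ι → ℝ}

theorem sum_mul_eq_of_cotangent_law (ha : ∀ r s, a s r = -a r s) (hb : ∀ r s, b s r = -b r s)
    (hab : ∀ r s t, r ≠ s → r ≠ t → s ≠ t → a r s * a r t = a s t * (b r s - b r t)) (s t : ι) :
    ∑ r, a r s * a r t = (if s = t then ∑ r, a s r ^ 2 else 0) +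
      a s t * (∑ r, b r s - ∑ r, b r t + 2 * b s t) := by
  have ha0 : ∀ r, a r r = 0 := fun r => by linarith [ha r r]
  have hb0 : ∀ r, b r r = 0 := fun r => by linarith [hb r r]
  by_cases hst : s = t
  · subst hst
    rw [if_pos rfl, ha0, zero_mul, add_zero]
    exact sum_congr rfl fun r _ => by rw [ha s r]; ring
  · rw [if_neg hst, zero_add]
    have summand_eq : ∀ r, a r s * a r t = a s t * (b r s - b r t) +
        ((if r = s then a s t * b s t else 0) + (if r = t then a s t * b s t else 0)) := by
      intro r
      by_cases hrs : r = s
      · subst hrs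
        simp [ha0, hb0, hst]
      · by_cases hrt : r = t
        · subst hrt
          simp [ha0, hb0, hrs, hb s r]
        · simp [hrs, hrt, hab r s t hrs hrt hst]
    simp only [summand_eq, sum_add_distrib, ← mul_sum, sum_sub_distrib, sum_ite_eq', mem_univ,
      if_true]
    ring

theorem mul_self_eq_add_commutator_of_cotangent_law (ha : ∀ r s, a s r = -a r s)
    (hb : ∀ r s, b s r = -b r s)
    (hab : ∀ r s t, r ≠ s → r ≠ t → s ≠ t → a r s * a r t = a s t * (b r s - b r t))
    {H C M : Matrix ι ι ℂ} (hH : H = Matrix.of fun r s => Complex.I * a r s)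
    (hC : C = Matrix.diagonal fun s => Complex.I * (-∑ r, b r s : ℝ))
    (hM : M = Matrix.of fun s t =>
      (((if s = t then ∑ r, a s r ^ 2 else 0) + 2 * (a s t * b s t) : ℝ) : ℂ)) :
    H * H = M + (C * H - H * C) := by
  ext s t
  have gram : (H * H) s t = ((∑ r, a r s * a r t : ℝ) : ℂ) := by
    simp only [hH, Matrix.mul_apply, Matrix.of_apply, ha _ s, Complex.ofReal_sum,
      Complex.ofReal_mul, Complex.ofReal_neg]
    exact sum_congr rfl fun r _ => by linear_combination -(a r s * a r t : ℂ) * Complex.I_sq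
  rw [gram, sum_mul_eq_of_cotangent_law ha hb hab, hM, hC, hH]
  simp only [Matrix.add_apply, Matrix.sub_apply, Matrix.diagonal_mul, Matrix.mul_diagonal,
    Matrix.of_apply]
  push_cast
  linear_combination (a s t : ℂ) * (∑ r, (b r s : ℂ) - ∑ r, (b r t : ℂ)) * Complex.I_sq

theorem norm_sq_le_of_cotangent_law (ha : ∀ r s, a s r = -a r s) (hb : ∀ r s, b s r = -b r s)
    (hab : ∀ r s t, r ≠ s → r ≠ t → s ≠ t → a r s * a r t = a s t * (b r s - b r t)) {c : ℝ}
    (hc : 0 ≤ c) (hsum : ∀ r, ∑ s, (a r s ^ 2 + 2 * |a r s * b r s|) ≤ c) :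
    ‖(Matrix.of fun r s => (a r s : ℂ) : Matrix ι ι ℂ)‖ ^ 2 ≤ c := by
  let H : Matrix ι ι ℂ := Matrix.of fun r s => Complex.I * a r s
  let M : Matrix ι ι ℂ := Matrix.of fun s t =>
    (((if s = t then ∑ r, a s r ^ 2 else 0) + 2 * (a s t * b s t) : ℝ) : ℂ)
  have hH : H.IsHermitian := by
    ext r s
    simp [H, ha r s]
  have hM : M.IsHermitian := by
    ext s t
    rcases eq_or_ne s t with rfl | hst
    · simp [M]
    · simp [M, hst, hst.symm, ha s t, hb s t]
  have norm_M : ‖M‖ ≤ c := by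
    refine norm_le_of_sum_norm_le hM hc fun s => le_trans ?_ (hsum s)
    calc ∑ t, ‖M s t‖ ≤ ∑ t, ((if s = t then ∑ r, a s r ^ 2 else 0) + 2 * |a s t * b s t|) := by
          refine sum_le_sum fun t _ => ?_
          simp only [M, Matrix.of_apply, Complex.norm_real, Real.norm_eq_abs]
          refine (abs_add_le _ _).trans (le_of_eq ?_)
          rw [abs_of_nonneg (by split_ifs <;> positivity), abs_mul 2, abs_two]
      _ = ∑ t, (a s t ^ 2 + 2 * |a s t * b s t|) := by simp [sum_add_distrib]
  calc _ = ‖Complex.I • Matrix.of fun r s => (a r s : ℂ)‖ ^ 2 := by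
        rw [norm_smul, Complex.norm_I, one_mul]
    _ ≤ ‖M‖ := norm_sq_le_of_sq_eq_add_commutator hH
        (mul_self_eq_add_commutator_of_cotangent_law ha hb hab rfl rfl rfl)
    _ ≤ c := norm_M

end CotangentKernel

section Cosecant

open Real

theorem one_add_two_mul_cos_mul_sq_le {x : ℝ} (hx0 : 0 ≤ x) (hx2 : x ≤ 2) :
    (1 + 2 * cos x) * x ^ 2 ≤ 3 * sin x ^ 2 := by
  have sin_sq_ge : ∀ y : ℝ, 0 ≤ y → y ≤ 2 → (y - y ^ 3 / 6) ^ 2 ≤ sin y ^ 2 := by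
    intro y h0 h2
    refine pow_le_pow_left₀ ?_ (sin_ge_sub_cube h0) 2
    nlinarith [mul_nonneg h0 (mul_nonneg (sub_nonneg.2 h2) h0), mul_nonneg h0 (sub_nonneg.2 h2)]
  have cos_le : cos x ≤ 1 - x ^ 2 / 2 + x ^ 4 / 24 := by
    have cos_eq : cos x = 1 - 2 * sin (x / 2) ^ 2 := by
      rw [sin_sq_eq_half_sub, mul_div_cancel₀ x two_ne_zero]
      ring
    nlinarith [sin_sq_ge (x / 2) (by linarith) (by linarith), pow_nonneg hx0 6]
  nlinarith [sin_sq_ge x hx0 hx2, mul_le_mul_of_nonneg_right cos_le (sq_nonneg x)]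

theorem inv_sin_mul_inv_sin {x y : ℝ} (hx : sin x ≠ 0) (hy : sin y ≠ 0) (hxy : sin (y - x) ≠ 0) :
    (sin x)⁻¹ * (sin y)⁻¹ = (sin (y - x))⁻¹ * (cot x - cot y) := by
  have cot_sub : cot x - cot y = sin (y - x) / (sin x * sin y) := by
    rw [cot_eq_cos_div_sin, cot_eq_cos_div_sin, sin_sub]
    field_simp
  rw [cot_sub]
  field_simp

theorem inv_sin_sq_add_two_mul_abs_inv_sin_mul_cot (x : ℝ) :
    (sin x)⁻¹ ^ 2 + 2 * |(sin x)⁻¹ * cot x| = (1 + 2 * |cos x|) / |sin x| ^ 2 := by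
  rw [cot_eq_cos_div_sin, abs_mul, abs_div, abs_inv, inv_pow, ← sq_abs (sin x)]
  ring

theorem inv_sin_sq_add_two_mul_abs_inv_sin_mul_cot_le (θ : ℝ) :
    (sin (π * θ))⁻¹ ^ 2 + 2 * |(sin (π * θ))⁻¹ * cot (π * θ)| ≤
      3 / π ^ 2 * (1 / (θ - round θ) ^ 2) := by
  set y := π * θ - round θ * π with hy
  have y_eq : y = π * (θ - round θ) := by rw [hy]; ring
  have abs_y_le : |y| ≤ π / 2 := by
    rw [y_eq, abs_mul, abs_of_pos pi_pos]
    nlinarith [abs_sub_round θ, pi_pos]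
  have abs_sin_eq : |sin (π * θ)| = sin |y| := by
    rw [← abs_sin_eq_sin_abs_of_abs_le_pi (by linarith [pi_pos]), hy, sin_sub_int_mul_pi, abs_mul,
      abs_neg_one_zpow, one_mul]
  have abs_cos_eq : |cos (π * θ)| = cos |y| := by
    rw [cos_abs, ← abs_of_nonneg (cos_nonneg_of_mem_Icc (abs_le.1 abs_y_le)), hy,
      cos_sub_int_mul_pi, abs_mul, abs_neg_one_zpow, one_mul]
  have rhs_eq : 3 / π ^ 2 * (1 / (θ - round θ) ^ 2) = 3 / |y| ^ 2 := by
    rw [sq_abs, y_eq, mul_pow, div_mul_div_comm, mul_one]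
  rw [inv_sin_sq_add_two_mul_abs_inv_sin_mul_cot, abs_sin_eq, abs_cos_eq, rhs_eq]
  rcases (abs_nonneg y).eq_or_lt with h0 | hpos
  · simp [← h0]
  · have := sin_pos_of_pos_of_lt_pi hpos (by linarith [pi_pos])
    rw [div_le_div_iff₀ (by positivity) (by positivity)]
    exact one_add_two_mul_cos_mul_sq_le hpos.le (by linarith [pi_le_four])

theorem sum_one_div_sq_le_of_pos {ι : Type*} (s : Finset ι) {y : ι → ℝ} {δ : ℝ} (hδ : 0 < δ)
    (hle : ∀ i ∈ s, δ ≤ y i) (hsep : (s : Set ι).Pairwise fun i j => δ ≤ |y i - y j|) :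
    ∑ i ∈ s, 1 / y i ^ 2 ≤ π ^ 2 / 6 / δ ^ 2 := by
  classical
  have floor_inj : Set.InjOn (fun i => ⌊y i / δ⌋₊) s := by
    intro i hi j hj hij
    by_contra hne
    have floor_eq : ⌊y i / δ⌋ = ⌊y j / δ⌋ := by
      rw [← Int.natCast_floor_eq_floor (div_nonneg (hδ.le.trans (hle i hi)) hδ.le),
        ← Int.natCast_floor_eq_floor (div_nonneg (hδ.le.trans (hle j hj)) hδ.le)]
      exact congrArg _ hij
    have hdiff := Int.abs_sub_lt_one_of_floor_eq_floor floor_eq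
    rw [← sub_div, abs_div, abs_of_pos hδ, div_lt_one hδ] at hdiff
    exact (hsep hi hj hne).not_gt hdiff
  have summand_le : ∀ i ∈ s, 1 / y i ^ 2 ≤ 1 / (⌊y i / δ⌋₊ : ℝ) ^ 2 / δ ^ 2 := by
    intro i hi
    have hy : 1 ≤ y i / δ := (one_le_div hδ).2 (hle i hi)
    have hfloor : 0 < (⌊y i / δ⌋₊ : ℝ) := Nat.cast_pos.2 (Nat.floor_pos.2 hy)
    rw [div_div, ← mul_pow]
    refine one_div_le_one_div_of_le (by positivity) (pow_le_pow_left₀ (by positivity) ?_ 2)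
    exact (le_div_iff₀ hδ).1 (Nat.floor_le (by linarith))
  calc ∑ i ∈ s, 1 / y i ^ 2 ≤ ∑ i ∈ s, 1 / (⌊y i / δ⌋₊ : ℝ) ^ 2 / δ ^ 2 := sum_le_sum summand_le
    _ = (∑ k ∈ s.image fun i => ⌊y i / δ⌋₊, 1 / (k : ℝ) ^ 2) / δ ^ 2 := by
        rw [← sum_div, sum_image floor_inj]
    _ ≤ π ^ 2 / 6 / δ ^ 2 := by
        gcongr
        exact sum_le_hasSum _ (fun k _ => by positivity) hasSum_zeta_two

theorem sum_one_div_sq_le {ι : Type*} (s : Finset ι) {y : ι → ℝ} {δ : ℝ} (hδ : 0 < δ)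
    (hle : ∀ i ∈ s, δ ≤ |y i|) (hsep : (s : Set ι).Pairwise fun i j => δ ≤ |y i - y j|) :
    ∑ i ∈ s, 1 / y i ^ 2 ≤ π ^ 2 / 3 / δ ^ 2 := by
  have pos_part : ∑ i ∈ s with 0 ≤ y i, 1 / y i ^ 2 ≤ π ^ 2 / 6 / δ ^ 2 := by
    refine sum_one_div_sq_le_of_pos _ hδ (fun i hi => ?_)
      (hsep.mono (coe_subset.2 (filter_subset _ _)))
    obtain ⟨his, hi0⟩ := mem_filter.1 hi
    exact (hle i his).trans_eq (abs_of_nonneg hi0)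
  have neg_part : ∑ i ∈ s with ¬0 ≤ y i, 1 / y i ^ 2 ≤ π ^ 2 / 6 / δ ^ 2 := by
    simp only [← neg_sq (y _)]
    refine sum_one_div_sq_le_of_pos _ hδ (fun i hi => ?_) fun i hi j hj hij => ?_
    · obtain ⟨his, hi0⟩ := mem_filter.1 hi
      exact (hle i his).trans_eq (abs_of_neg (not_le.1 hi0))
    · change δ ≤ |-y i - -y j|
      rw [neg_sub_neg, abs_sub_comm]
      exact hsep (mem_filter.1 hi).1 (mem_filter.1 hj).1 hij
  calc ∑ i ∈ s, 1 / y i ^ 2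
      = ∑ i ∈ s with 0 ≤ y i, 1 / y i ^ 2 + ∑ i ∈ s with ¬0 ≤ y i, 1 / y i ^ 2 :=
        (sum_filter_add_sum_filter_not s _ _).symm
    _ ≤ π ^ 2 / 6 / δ ^ 2 + π ^ 2 / 6 / δ ^ 2 := add_le_add pos_part neg_part
    _ = π ^ 2 / 3 / δ ^ 2 := by ring

end Cosecant

section HilbertInequality

open Real

/-- The points `x i`, read modulo `1`, are `δ`-separated on the circle `ℝ / ℤ`: any two distinct
lifts `x i + k` to the line are at distance at least `δ`. Lifts of the same point count, so even
a single point is `δ`-separated only for `δ ≤ 1`. -/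
def CircleSeparated {ι : Type*} (δ : ℝ) (x : ι → ℝ) : Prop :=
  Pairwise fun a b : ι × ℤ => δ ≤ |x a.1 + a.2 - (x b.1 + b.2)|

/-- The matrix of Hilbert's inequality on the circle for the points `x i`, with zero diagonal
because `(sin 0)⁻¹ = 0`. -/
noncomputable def cosecantMatrix {ι : Type*} (x : ι → ℝ) : Matrix ι ι ℂ :=
  Matrix.of fun i j => (((sin (π * (x i - x j)))⁻¹ : ℝ) : ℂ)

variable {ι : Type*} {δ : ℝ} {x : ι → ℝ}

theorem CircleSeparated.le_abs_sub_intCast (hx : CircleSeparated δ x) {i j : ι} (hij : i ≠ j)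
    (k : ℤ) : δ ≤ |x i - x j - k| := by
  have := @hx (i, 0) (j, k) (by simp [hij])
  simpa [sub_sub] using this

theorem CircleSeparated.sin_ne_zero (hδ : 0 < δ) (hx : CircleSeparated δ x) {i j : ι}
    (hij : i ≠ j) : sin (π * (x i - x j)) ≠ 0 := by
  intro h
  obtain ⟨k, hk⟩ := sin_eq_zero_iff.1 h
  have hk : x i - x j - k = 0 := by
    rw [mul_comm, mul_right_inj' pi_ne_zero] at hk
    rw [hk, sub_self]
  have := hx.le_abs_sub_intCast hij k
  rw [hk, abs_zero] at this
  exact hδ.not_ge this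

variable [Fintype ι]

theorem CircleSeparated.sum_inv_sin_sq_add_le (hδ : 0 < δ) (hx : CircleSeparated δ x)
    (i : ι) :
    ∑ j, ((sin (π * (x i - x j)))⁻¹ ^ 2 +
      2 * |(sin (π * (x i - x j)))⁻¹ * cot (π * (x i - x j))|) ≤ 1 / δ ^ 2 := by
  classical
  rw [← sum_erase univ (a := i) (by simp)]
  refine (sum_le_sum fun j _ => inv_sin_sq_add_two_mul_abs_inv_sin_mul_cot_le _).trans ?_
  have separated := sum_one_div_sq_le (univ.erase i)
    (y := fun j => x i - x j - round (x i - x j)) hδ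
    (fun j hj => hx.le_abs_sub_intCast (ne_of_mem_erase hj).symm _) (fun j _ k _ hjk => by
      convert hx.le_abs_sub_intCast hjk.symm (round (x i - x j) - round (x i - x k)) using 2
      push_cast
      ring)
  calc _ = 3 / π ^ 2 * ∑ j ∈ univ.erase i, 1 / (x i - x j - round (x i - x j)) ^ 2 :=
        (mul_sum _ _ _).symm
    _ ≤ 3 / π ^ 2 * (π ^ 2 / 3 / δ ^ 2) := by gcongr
    _ = 1 / δ ^ 2 := by field_simp

theorem CircleSeparated.norm_cosecantMatrix_le [DecidableEq ι] (hδ : 0 < δ)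
    (hx : CircleSeparated δ x) : ‖cosecantMatrix x‖ ≤ 1 / δ := by
  have skew (i j : ι) : π * (x j - x i) = -(π * (x i - x j)) := by ring
  rw [← pow_le_pow_iff_left₀ (norm_nonneg _) (by positivity) two_ne_zero, one_div_pow]
  refine norm_sq_le_of_cotangent_law (b := fun i j => cot (π * (x i - x j))) (fun i j => ?_)
    (fun i j => ?_) (fun i j k hij hik hjk => ?_) (by positivity) (hx.sum_inv_sin_sq_add_le hδ)
  · rw [skew, sin_neg, inv_neg]
  · rw [skew, cot_eq_cos_div_sin, cot_eq_cos_div_sin, cos_neg, sin_neg, div_neg]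
  · have hsub : π * (x i - x k) - π * (x i - x j) = π * (x j - x k) := by ring
    rw [← hsub]
    refine inv_sin_mul_inv_sin (hx.sin_ne_zero hδ hij) (hx.sin_ne_zero hδ hik) ?_
    rw [hsub]
    exact hx.sin_ne_zero hδ hjk

end HilbertInequality

section LargeSieveInequality

open scoped FourierTransform
open Real

theorem fourierChar_add (s t : ℝ) : (𝐞 (s + t) : ℂ) = 𝐞 s * 𝐞 t := by
  rw [AddChar.map_add_eq_mul, Circle.coe_mul]

theorem star_fourierChar (t : ℝ) : star (𝐞 t : ℂ) = 𝐞 (-t) := by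
  rw [AddChar.map_neg_eq_inv, Circle.coe_inv_eq_conj, Complex.star_def]

theorem fourierChar_intCast (k : ℤ) : (𝐞 (k : ℝ) : ℂ) = 1 := by
  rw [fourierChar_apply, Complex.exp_eq_one_iff]
  exact ⟨k, by push_cast; ring⟩

theorem fourierChar_half_sub_fourierChar_neg_half (θ : ℝ) :
    (𝐞 (θ / 2) : ℂ) - 𝐞 (-(θ / 2)) = 2 * Complex.I * sin (π * θ) := by
  have exp_half (t : ℝ) : (𝐞 (t / 2) : ℂ) = Complex.exp ((π * t : ℝ) * Complex.I) := by
    rw [fourierChar_apply]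
    ring_nf
  rw [← neg_div, exp_half, exp_half, mul_neg, Complex.ofReal_neg, Complex.ofReal_sin]
  linear_combination -Complex.I * Complex.two_sin (π * θ : ℝ) +
    (Complex.exp ((π * θ : ℝ) * Complex.I) - Complex.exp (-(π * θ : ℝ) * Complex.I)) *
      Complex.I_sq

theorem sum_fourierChar_mul_sin (a : ℤ) (W : ℕ) (θ : ℝ) :
    (∑ k ∈ range W, (𝐞 ((a + k) * θ) : ℂ)) * (2 * Complex.I * sin (π * θ)) =
      𝐞 ((a + W - 1 / 2) * θ) - 𝐞 ((a - 1 / 2) * θ) := by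
  have telescope : ∀ k : ℕ, (𝐞 ((a + k) * θ) : ℂ) * (2 * Complex.I * sin (π * θ)) =
      𝐞 ((a + (k + 1 : ℕ) - 1 / 2) * θ) - 𝐞 ((a + k - 1 / 2) * θ) := by
    intro k
    rw [← fourierChar_half_sub_fourierChar_neg_half, mul_sub, ← fourierChar_add, ← fourierChar_add]
    congr 4 <;> push_cast <;> ring
  rw [sum_mul, sum_congr rfl fun k _ => telescope k,
    sum_range_sub fun k : ℕ => (𝐞 ((a + k - 1 / 2) * θ) : ℂ), Nat.cast_zero, add_zero]

theorem sum_fourierChar_eq_zero (a : ℤ) {W : ℕ} {θ : ℝ} (hθ : sin (π * θ) ≠ 0)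
    (hW : (𝐞 (W * θ) : ℂ) = 1) : ∑ k ∈ range W, (𝐞 ((a + k) * θ) : ℂ) = 0 := by
  have h := sum_fourierChar_mul_sin a W θ
  rw [add_sub_right_comm, add_mul, fourierChar_add, hW, mul_one, sub_self] at h
  exact (mul_eq_zero.1 h).resolve_right <| mul_ne_zero
    (mul_ne_zero two_ne_zero Complex.I_ne_zero) (Complex.ofReal_ne_zero.2 hθ)

/-- The diagonal unitary matrix with entries `𝐞 (c * x i)`: evaluated at the points `x i`, it
translates all frequencies by `c`. -/
noncomputable def modulation {ι : Type*} [DecidableEq ι] (c : ℝ) (x : ι → ℝ) : Matrix ι ι ℂ :=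
  Matrix.diagonal fun i => (𝐞 (c * x i) : ℂ)

theorem norm_modulation_le {ι : Type*} [Fintype ι] [DecidableEq ι] (c : ℝ) (x : ι → ℝ) :
    ‖modulation c x‖ ≤ 1 := by
  rw [modulation, Matrix.l2_opNorm_diagonal]
  exact (pi_norm_le_iff_of_nonneg zero_le_one).2 fun i => (Circle.norm_coe _).le

theorem modulation_mul_mul_conjTranspose_apply {ι : Type*} [Fintype ι] [DecidableEq ι] (c : ℝ)
    (x : ι → ℝ) (S : Matrix ι ι ℂ) (i j : ι) :
    (modulation c x * S * (modulation c x)ᴴ) i j = 𝐞 (c * (x i - x j)) * S i j := by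
  rw [modulation, Matrix.diagonal_conjTranspose, Matrix.mul_diagonal, Matrix.diagonal_mul,
    Pi.star_apply, star_fourierChar, mul_right_comm, ← fourierChar_add, mul_sub, sub_eq_add_neg]

/-- The matrix of the exponentials with integer frequencies `ν k` at the points `x i`, with
`𝐞 t = exp (2πit)`. The square of its operator norm is the best constant in the large sieve
inequality for these frequencies and points. -/
noncomputable def expMatrix {ι κ : Type*} (ν : κ → ℤ) (x : ι → ℝ) : Matrix ι κ ℂ :=
  Matrix.of fun i k => (𝐞 (ν k * x i) : ℂ)

theorem expMatrix_mul_conjTranspose_apply {ι κ : Type*} [Fintype κ] (ν : κ → ℤ) (x : ι → ℝ)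
    (i j : ι) :
    (expMatrix ν x * (expMatrix ν x)ᴴ) i j = ∑ k, (𝐞 (ν k * (x i - x j)) : ℂ) := by
  simp only [expMatrix, Matrix.mul_apply, Matrix.conjTranspose_apply, Matrix.of_apply,
    star_fourierChar, ← fourierChar_add, ← mul_neg, ← mul_add, ← sub_eq_add_neg]

variable {ι κ : Type*} [Fintype ι] [Fintype κ] [DecidableEq κ] {δ : ℝ} {x : ι → ℝ}

theorem CircleSeparated.expMatrix_mul_conjTranspose [DecidableEq ι] (hδ : 0 < δ)
    (hx : CircleSeparated δ x) (a : ℤ) (W : ℕ) :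
    expMatrix (fun k : Fin W => a + k) x * (expMatrix (fun k : Fin W => a + k) x)ᴴ =
      (W : ℂ) • 1 + (2 * Complex.I)⁻¹ •
        (modulation (a + W - 1 / 2) x * cosecantMatrix x * (modulation (a + W - 1 / 2) x)ᴴ -
          modulation (a - 1 / 2) x * cosecantMatrix x * (modulation (a - 1 / 2) x)ᴴ) := by
  ext i j
  rw [Matrix.add_apply, Matrix.smul_apply, Matrix.smul_apply, Matrix.sub_apply,
    modulation_mul_mul_conjTranspose_apply, modulation_mul_mul_conjTranspose_apply, smul_eq_mul,
    smul_eq_mul, expMatrix_mul_conjTranspose_apply, ← sub_mul, ← sum_fourierChar_mul_sin,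
    cosecantMatrix, Matrix.of_apply]
  rcases eq_or_ne i j with rfl | hij
  · simp
  · have two_I_ne : 2 * Complex.I ≠ 0 := mul_ne_zero two_ne_zero Complex.I_ne_zero
    have sin_ne : (sin (π * (x i - x j)) : ℂ) ≠ 0 :=
      Complex.ofReal_ne_zero.2 (hx.sin_ne_zero hδ hij)
    rw [Matrix.one_apply_ne hij, Complex.ofReal_inv, mul_zero, zero_add,
      mul_assoc, mul_assoc _ _ (_⁻¹), mul_inv_cancel₀ sin_ne, mul_one, mul_left_comm,
      inv_mul_cancel₀ two_I_ne, mul_one,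
      ← Fin.sum_univ_eq_sum_range fun k : ℕ => (𝐞 ((a + k) * (x i - x j)) : ℂ)]
    push_cast
    rfl

theorem CircleSeparated.norm_expMatrix_fin_sq_le (hδ : 0 < δ) (hx : CircleSeparated δ x) (a : ℤ)
    (W : ℕ) : ‖expMatrix (fun k : Fin W => a + k) x‖ ^ 2 ≤ W + 1 / δ := by
  classical
  have conj_le (c : ℝ) :
      ‖modulation c x * cosecantMatrix x * (modulation c x)ᴴ‖ ≤ 1 / δ := by
    calc _ ≤ ‖modulation c x‖ * ‖cosecantMatrix x‖ * ‖(modulation c x)ᴴ‖ := norm_mul₃_le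
      _ ≤ 1 * (1 / δ) * 1 := by
        rw [Matrix.l2_opNorm_conjTranspose]
        gcongr
        · exact norm_modulation_le c x
        · exact hx.norm_cosecantMatrix_le hδ
        · exact norm_modulation_le c x
      _ = 1 / δ := by ring
  rw [norm_sq_eq_norm_mul_conjTranspose_self, hx.expMatrix_mul_conjTranspose hδ a W]
  refine (norm_add_le _ _).trans (add_le_add ?_ ?_)
  · rw [norm_smul, Complex.norm_natCast]
    exact mul_le_of_le_one_right (Nat.cast_nonneg _) norm_one_matrix_le
  · rw [norm_smul, norm_inv, norm_mul, Complex.norm_I, Complex.norm_two, mul_one]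
    refine (mul_le_mul_of_nonneg_left ((norm_sub_le _ _).trans (add_le_add (conj_le _) (conj_le _)))
      (by positivity)).trans_eq ?_
    ring

theorem CircleSeparated.norm_expMatrix_sq_le_add (hδ : 0 < δ) (hx : CircleSeparated δ x)
    {ν : κ → ℤ} (hν : ν.Injective) {a : ℤ} {W : ℕ} (hmem : ∀ k, ν k ∈ Set.Ico a (a + W)) :
    ‖expMatrix ν x‖ ^ 2 ≤ W + 1 / δ := by
  let g : κ → Fin W := fun k => ⟨(ν k - a).toNat, by have := hmem k; simp at this; omega⟩
  have hg (k : κ) : a + (g k : ℕ) = ν k := by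
    have := (hmem k).1
    simp only [g]
    omega
  have hg_inj : g.Injective := fun k l hkl => hν (by rw [← hg k, ← hg l, hkl])
  have submatrix_eq : expMatrix ν x = (expMatrix (fun k : Fin W => a + k) x).submatrix id g := by
    ext i k
    simp [expMatrix, ← hg k]
  rw [submatrix_eq]
  exact (pow_le_pow_left₀ (norm_nonneg _)
    (norm_submatrix_le _ Function.injective_id hg_inj) 2).trans
      (hx.norm_expMatrix_fin_sq_le hδ a W)

end LargeSieveInequality

section Covering

open Real

/-- The preimages of the points `x i` under multiplication by `T` on the circle `ℝ / ℤ`, the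
preimages of `x i` being indexed by `Fin T`. -/
noncomputable def circleCover {ι : Type*} (T : ℕ) (x : ι → ℝ) : ι × Fin T → ℝ :=
  fun a => (x a.1 + (a.2 : ℕ)) / T

variable {ι κ : Type*} {δ : ℝ} {x : ι → ℝ} {T : ℕ}

theorem CircleSeparated.circleCover (hT : 0 < T) (hx : CircleSeparated δ x) :
    CircleSeparated (δ / T) (circleCover T x) := by
  rintro ⟨⟨i, s⟩, k⟩ ⟨⟨j, t⟩, l⟩ hne
  have hT' : (0 : ℝ) < T := Nat.cast_pos.2 hT
  have lifts_ne : ((i, s + T * k) : ι × ℤ) ≠ (j, t + T * l) := by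
    rintro h
    obtain ⟨rfl, hst⟩ := Prod.mk.inj h
    have hmod : (s : ℕ) ≡ t [MOD T] := by
      rw [← Int.natCast_modEq_iff]
      simpa [Int.ModEq] using congrArg (· % (T : ℤ)) hst
    obtain rfl : s = t := Fin.ext (hmod.eq_of_lt_of_lt s.2 t.2)
    have : k = l := by simpa [hT.ne'] using hst
    exact hne (by rw [this])
  have lift_eq : ∀ (i : ι) (s : Fin T) (k : ℤ), LargeSieve.circleCover T x (i, s) + k =
      (x i + (s + T * k : ℤ)) / T := by
    intro i s k
    simp only [LargeSieve.circleCover]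
    push_cast
    field_simp
    ring
  change δ / T ≤ |LargeSieve.circleCover T x (i, s) + k - (LargeSieve.circleCover T x (j, t) + l)|
  rw [lift_eq, lift_eq, ← sub_div, abs_div, abs_of_pos hT']
  exact div_le_div_of_nonneg_right (hx lifts_ne) hT'.le

variable [Fintype ι] [Fintype κ] [DecidableEq κ]

theorem norm_expMatrix_circleCover_sq (hT : 0 < T) (ν : κ → ℤ) (x : ι → ℝ) :
    ‖expMatrix (fun k => T * ν k) (circleCover T x)‖ ^ 2 = T * ‖expMatrix ν x‖ ^ 2 := by
  have submatrix_eq : expMatrix (fun k => T * ν k) (circleCover T x) =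
      (expMatrix ν x).submatrix Prod.fst id := by
    ext ⟨i, t⟩ k
    have hT' : (T : ℝ) ≠ 0 := Nat.cast_ne_zero.2 hT.ne'
    have arg_eq : ((T * ν k : ℤ) : ℝ) * ((x i + (t : ℕ)) / T) = ν k * x i + (ν k * t : ℤ) := by
      push_cast
      field_simp
    simp only [expMatrix, circleCover, Matrix.of_apply, Matrix.submatrix_apply, id, arg_eq]
    rw [fourierChar_add, fourierChar_intCast, mul_one]
  rw [submatrix_eq, norm_submatrix_fst_sq, Fintype.card_fin]

/-- Passing to the `T`-fold cover multiplies everything but the surplus `1` in the trivial count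
`d + 1` of frequencies by `T`, so `T → ∞` removes it. -/
theorem CircleSeparated.norm_expMatrix_sq_le (hδ : 0 < δ) (hx : CircleSeparated δ x)
    {ν : κ → ℤ} (hν : ν.Injective) {a : ℤ} {d : ℕ} (hmem : ∀ k, ν k ∈ Set.Icc a (a + d)) :
    ‖expMatrix ν x‖ ^ 2 ≤ d + 1 / δ := by
  have cover_bound (T : ℕ) (hT : 0 < T) : T * (‖expMatrix ν x‖ ^ 2 - (d + 1 / δ)) ≤ 1 := by
    have h := (hx.circleCover hT).norm_expMatrix_sq_le_add (by positivity)
      (ν := fun k => T * ν k) (a := T * a) (W := T * d + 1)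
      (fun k l hkl => hν (by simpa [hT.ne'] using hkl)) (fun k => by
        obtain ⟨h1, h2⟩ := hmem k
        constructor
        · exact mul_le_mul_of_nonneg_left h1 (by positivity)
        · have := mul_le_mul_of_nonneg_left h2 (Int.natCast_nonneg T)
          push_cast
          linarith)
    rw [norm_expMatrix_circleCover_sq hT, one_div_div] at h
    push_cast at h
    linear_combination h
  by_contra! hlt
  obtain ⟨T, hT⟩ := exists_nat_gt (1 / (‖expMatrix ν x‖ ^ 2 - (d + 1 / δ)))
  have hpos := sub_pos.2 hlt
  have hT0 : 0 < T := Nat.cast_pos.1 ((one_div_pos.2 hpos).trans hT)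
  exact ((div_lt_iff₀ hpos).1 hT).not_ge (cover_bound T hT0)

theorem norm_expMatrix_sq_le_of_coloring (hδ : 0 < δ) {N : ℕ} (hN : 0 < N)
    (color : ι × Fin N → Fin N)
    (hsep : ∀ j, CircleSeparated (δ / N) fun a : {a // color a = j} => circleCover N x a)
    {ν : κ → ℤ} (hν : ν.Injective) {a : ℤ} {d : ℕ} (hmem : ∀ k, ν k ∈ Set.Icc a (a + d)) :
    ‖expMatrix ν x‖ ^ 2 ≤ N * (d + 1 / δ) := by
  have hN' : (0 : ℝ) < N := Nat.cast_pos.2 hN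
  have class_bound (j : Fin N) : ‖(expMatrix (fun k => N * ν k) (circleCover N x)).submatrix
      (Subtype.val : {a // color a = j} → ι × Fin N) id‖ ^ 2 ≤ N * (d + 1 / δ) := by
    refine ((hsep j).norm_expMatrix_sq_le (by positivity) (ν := fun k => N * ν k) (a := N * a)
      (d := N * d) (fun k l hkl => hν (by simpa [hN.ne'] using hkl)) fun k => ?_).trans_eq ?_
    · obtain ⟨h1, h2⟩ := hmem k
      have := mul_le_mul_of_nonneg_left h2 (Int.natCast_nonneg N)
      exact ⟨mul_le_mul_of_nonneg_left h1 (by positivity), by push_cast; linarith⟩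
    · rw [one_div_div]
      push_cast
      ring
  refine le_of_mul_le_mul_left ?_ hN'
  calc N * ‖expMatrix ν x‖ ^ 2 = ‖expMatrix (fun k => N * ν k) (circleCover N x)‖ ^ 2 :=
        (norm_expMatrix_circleCover_sq hN ν x).symm
    _ ≤ ∑ j : Fin N, N * (d + 1 / δ) :=
        (norm_sq_le_sum_norm_submatrix_fiber_sq _ color).trans
          (sum_le_sum fun j _ => class_bound j)
    _ = N * (N * (d + 1 / δ)) := by rw [sum_const, card_univ, Fintype.card_fin, nsmul_eq_mul]

end Covering

section PeriodicSet

variable {A : ℕ → Prop} {m L N : ℕ}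

theorem mem_add_mul_period (hA : Function.Periodic A m) {a : ℕ} (ha : A a) (k : ℕ) :
    A (a + k * m) := by
  simpa using (hA.nat_mul k a).symm ▸ ha

variable [DecidablePred A]

theorem count_add_mul_period (hA : Function.Periodic A m) (a k : ℕ) :
    Nat.count A (a + k * m) = Nat.count A a + k * Nat.count A m := by
  have shift (b : ℕ) : Nat.count A (m + b) = Nat.count A m + Nat.count A b := by
    rw [Nat.count_add]
    simp only [add_comm m, hA _]
  induction k with
  | zero => simp
  | succ k ih => rw [add_one_mul, ← add_assoc, add_comm, shift, ih]; ring

theorem add_le_of_count_modEq (hcount : ∀ a, Nat.count A (a + L) ≤ Nat.count A a + N) {a b : ℕ}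
    (ha : A a) (hb : A b) (hlt : a < b) (hmod : Nat.count A a ≡ Nat.count A b [MOD N]) :
    a + L ≤ b := by
  by_contra! hbL
  have upper : Nat.count A b + 1 ≤ Nat.count A a + N := by
    rw [← Nat.count_succ_eq_succ_count_iff.2 hb]
    exact (Nat.count_monotone A hbL).trans (hcount a)
  have lower : Nat.count A a + N ≤ Nat.count A b := hmod.add_le_of_lt (Nat.count_strict_mono ha hlt)
  omega

theorem le_abs_sub_of_count_modEq (hA : Function.Periodic A m)
    (hcount : ∀ a, Nat.count A (a + L) ≤ Nat.count A a + N) {a b : ℕ} (ha : A a) (hb : A b)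
    (hmod : Nat.count A a ≡ Nat.count A b [MOD N]) {k : ℤ} (hne : (a : ℤ) - b ≠ k * (N * m)) :
    (L : ℤ) ≤ |(a : ℤ) - b - k * (N * m)| := by
  have separated {a b : ℕ} (ha : A a) (hb : A b)
      (hmod : Nat.count A a ≡ Nat.count A b [MOD N]) (hne : a ≠ b) : (L : ℤ) ≤ |(a : ℤ) - b| := by
    rcases hne.lt_or_gt with hlt | hlt
    · have := add_le_of_count_modEq hcount ha hb hlt hmod
      rw [le_abs]; omega
    · have := add_le_of_count_modEq hcount hb ha hlt hmod.symm
      rw [le_abs]; omega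
  have count_shift (a k : ℕ) : Nat.count A (a + k * N * m) ≡ Nat.count A a [MOD N] := by
    rw [count_add_mul_period hA, mul_right_comm]
    simp [Nat.ModEq]
  obtain ⟨k, rfl | rfl⟩ := k.eq_nat_or_neg
  · have := separated ha (mem_add_mul_period hA hb _) (hmod.trans (count_shift b k).symm) (by
      rintro rfl; apply hne; push_cast; ring)
    push_cast at this
    rwa [← mul_assoc, sub_sub]
  · have := separated (mem_add_mul_period hA ha _) hb ((count_shift a k).trans hmod) (by
      rintro rfl; apply hne; push_cast; ring)
    push_cast at this
    convert this using 2
    ring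

variable {ι κ : Type*} {p : ι → ℕ}

theorem eq_and_eq_zero_of_sub_eq_mul (hp_inj : ∀ ⦃i j⦄, p i ≡ p j [MOD m] → i = j) (hm : 0 < m)
    {b c : ι × Fin N} {k : ℤ}
    (h : ((p b.1 + b.2 * m : ℕ) : ℤ) - (p c.1 + c.2 * m : ℕ) = k * (N * m)) : b = c ∧ k = 0 := by
  obtain ⟨i, s⟩ := b
  obtain ⟨j, t⟩ := c
  push_cast at h
  obtain rfl : i = j := hp_inj <| Int.natCast_modEq_iff.1 <| Int.modEq_iff_dvd.2
    ⟨s - t - k * N, by linear_combination -h⟩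
  have hm' : (m : ℤ) ≠ 0 := by exact_mod_cast hm.ne'
  have hst : (s : ℤ) - t = k * N := mul_right_cancel₀ hm' (by linear_combination h)
  obtain rfl : s = t := Fin.ext <| Nat.ModEq.eq_of_lt_of_lt (Int.natCast_modEq_iff.1 <|
    Int.modEq_iff_dvd.2 ⟨-k, by linear_combination -hst⟩) s.2 t.2
  simpa [s.pos.ne'] using hst

theorem div_le_abs_circleCover_sub (hA : Function.Periodic A m)
    (hcount : ∀ a, Nat.count A (a + L) ≤ Nat.count A a + N) (hm : 0 < m) (hp : ∀ i, A (p i))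
    (hp_inj : ∀ ⦃i j⦄, p i ≡ p j [MOD m] → i = j) {b c : ι × Fin N}
    (hmod : Nat.count A (p b.1 + b.2 * m) ≡ Nat.count A (p c.1 + c.2 * m) [MOD N]) {k l : ℤ}
    (hne : (b, k) ≠ (c, l)) :
    (L / m / N : ℝ) ≤ |circleCover N (fun i => (p i / m : ℝ)) b + k -
      (circleCover N (fun i => (p i / m : ℝ)) c + l)| := by
  have hm' : (0 : ℝ) < m := Nat.cast_pos.2 hm
  have hN' : (0 : ℝ) < N := Nat.cast_pos.2 b.2.pos
  have lift_sub_eq : circleCover N (fun i => (p i / m : ℝ)) b + k -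
      (circleCover N (fun i => (p i / m : ℝ)) c + l) =
      (((p b.1 + b.2 * m : ℕ) - (p c.1 + c.2 * m : ℕ) - (l - k) * (N * m) : ℤ) : ℝ) / (m * N) := by
    simp only [circleCover]
    push_cast
    field_simp
    ring
  rw [lift_sub_eq, abs_div, abs_of_pos (mul_pos hm' hN'), div_div]
  refine div_le_div_of_nonneg_right ?_ (mul_pos hm' hN').le
  rw [← Int.cast_abs, ← Int.cast_natCast (R := ℝ) L, Int.cast_le]
  refine le_abs_sub_of_count_modEq hA hcount (mem_add_mul_period hA (hp _) _)
    (mem_add_mul_period hA (hp _) _) hmod fun h => hne ?_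
  obtain ⟨rfl, hkl⟩ := eq_and_eq_zero_of_sub_eq_mul hp_inj hm h
  rw [sub_eq_zero.1 hkl]

theorem norm_expMatrix_sq_le_of_periodic [Fintype ι] [Fintype κ] [DecidableEq κ]
    (hA : Function.Periodic A m) (hm : 0 < m) (hL : 0 < L)
    (hcount : ∀ a, Nat.count A (a + L) ≤ Nat.count A a + N) (hp : ∀ i, A (p i))
    (hp_inj : ∀ ⦃i j⦄, p i ≡ p j [MOD m] → i = j) {ν : κ → ℤ} (hν : ν.Injective) {a : ℤ} {d : ℕ}
    (hmem : ∀ k, ν k ∈ Set.Icc a (a + d)) :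
    ‖expMatrix ν (fun i => (p i / m : ℝ))‖ ^ 2 ≤ N * (d + m / L) := by
  rcases isEmpty_or_nonempty ι with hι | ⟨⟨i₀⟩⟩
  · simp only [Subsingleton.elim (expMatrix ν _) 0, norm_zero, ne_eq, two_ne_zero,
      not_false_eq_true, zero_pow]
    positivity
  have hN : 0 < N := by
    by_contra! h0
    have h := (Nat.count_monotone A (show p i₀ + 1 ≤ p i₀ + L by omega)).trans (hcount (p i₀))
    rw [Nat.count_succ_eq_succ_count_iff.2 (hp i₀)] at h
    omega
  rw [← one_div_div (L : ℝ) m]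
  refine norm_expMatrix_sq_le_of_coloring (by positivity) hN
    (fun b => ⟨Nat.count A (p b.1 + b.2 * m) % N, Nat.mod_lt _ hN⟩) (fun j => ?_) hν hmem
  rintro ⟨⟨b, hb⟩, k⟩ ⟨⟨c, hc⟩, l⟩ hne
  refine div_le_abs_circleCover_sub hA hcount hm hp hp_inj
    (Fin.mk.inj_iff.1 (hb.trans hc.symm)) fun h => hne ?_
  obtain ⟨rfl, rfl⟩ := Prod.mk.inj h
  rfl

end PeriodicSet

section NyquistDensity

/-- The periodic set of the natural numbers congruent to an element of `P` modulo `m`. -/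
def periodization {m : ℕ} (P : Finset (Idx m)) (k : ℕ) : Prop :=
  ∃ p ∈ P, (p : ℕ) ≡ k [MOD m]

instance {m : ℕ} (P : Finset (Idx m)) : DecidablePred (periodization P) :=
  fun k => inferInstanceAs (Decidable (∃ p ∈ P, (p : ℕ) ≡ k [MOD m]))

variable {m : ℕ} {P : Finset (Idx m)}

theorem periodization_congr {a b : ℕ} (hab : a ≡ b [MOD m]) :
    periodization P a ↔ periodization P b :=
  exists_congr fun _ => and_congr_right fun _ => ⟨(·.trans hab), (·.trans hab.symm)⟩

theorem periodic_periodization (P : Finset (Idx m)) :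
    Function.Periodic (periodization P) m :=
  fun a => propext (periodization_congr (by simp [Nat.ModEq]))

theorem mem_doubled_of_periodization {k : ℕ} (hk : k ∈ Set.Ico 1 (2 * m))
    (h : periodization P k) : k ∈ doubled P := by
  obtain ⟨p, hpP, hpk⟩ := h
  have hp := mem_Icc.1 p.2
  obtain ⟨hk1, hk2⟩ := hk
  simp only [doubled, mem_union, mem_image]
  rcases le_or_gt k m with hkm | hkm
  · refine .inl ⟨p, hpP, ?_⟩
    rcases le_total k (p : ℕ) with _ | _
    · exact (hpk.symm.eq_of_abs_lt (by rw [abs_lt]; omega)).symm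
    · exact hpk.eq_of_abs_lt (by rw [abs_lt]; omega)
  · refine .inr ⟨p, hpP, Nat.ModEq.eq_of_abs_lt (m := m) (by simpa [Nat.ModEq] using hpk) ?_⟩
    push_cast
    rw [abs_lt]; omega

theorem card_filter_Ico_ceil_le_maxOpenCount {lam : ℝ} (hlam : lam ∈ Set.Ioc (0 : ℝ) m) {b : ℕ}
    (hb : b ∈ Set.Icc 1 m) :
    #{k ∈ Ico b (b + ⌈lam⌉₊) | periodization P k} ≤ maxOpenCount P lam := by
  obtain ⟨hb1, hbm⟩ := hb
  have hb1' : (1 : ℝ) ≤ b := by exact_mod_cast hb1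
  have hbm' : (b : ℝ) ≤ m := by exact_mod_cast hbm
  have ceil_lt := Nat.ceil_lt_add_one hlam.1.le
  have le_ceil := Nat.le_ceil lam
  have ceil_le : ⌈lam⌉₊ ≤ m := Nat.ceil_le.2 hlam.2
  set r : ℝ := b - (lam + 1 - ⌈lam⌉₊) / 2 with hr
  have count_le : openCount P lam r ≤ maxOpenCount P lam :=
    (isGreatest_maxOpenCount (hb1.trans hbm) P lam).2 ⟨r, ⟨by linarith, by linarith⟩, rfl⟩
  refine (card_le_card fun k hk => ?_).trans count_le
  obtain ⟨hk, hkP⟩ := mem_filter.1 hk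
  obtain ⟨hbk, hkL⟩ := mem_Ico.1 hk
  have hbk' : (b : ℝ) ≤ k := by exact_mod_cast hbk
  have hkL' : (k : ℝ) + 1 ≤ b + ⌈lam⌉₊ := by exact_mod_cast hkL
  refine mem_filter.2 ⟨mem_doubled_of_periodization ⟨by omega, by omega⟩ hkP, ?_, ?_⟩ <;> linarith

theorem count_periodization_add_ceil_le {lam : ℝ} (hlam : lam ∈ Set.Ioc (0 : ℝ) m) (a : ℕ) :
    Nat.count (periodization P) (a + ⌈lam⌉₊) ≤
      Nat.count (periodization P) a + maxOpenCount P lam := by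
  have hm : 0 < m := Nat.cast_pos.1 (hlam.1.trans_le hlam.2)
  obtain ⟨b, hb, hab⟩ : ∃ b ∈ Set.Icc 1 m, a ≡ b [MOD m] := by
    rcases (a % m).eq_zero_or_pos with h0 | hpos
    · exact ⟨m, ⟨hm, le_rfl⟩, by simpa [Nat.ModEq] using h0⟩
    · exact ⟨a % m, ⟨hpos, (Nat.mod_lt a hm).le⟩, (Nat.mod_modEq a m).symm⟩
  have window_eq : Nat.count (fun k => periodization P (b + k)) ⌈lam⌉₊ =
      #{k ∈ Ico b (b + ⌈lam⌉₊) | periodization P k} := by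
    rw [Nat.count_eq_card_filter_range, card_filter, card_filter, sum_Ico_eq_sum_range,
      add_tsub_cancel_left]
  rw [Nat.count_add, add_le_add_iff_left]
  simp only [periodization_congr (hab.add_right _)]
  exact window_eq.trans_le (card_filter_Ico_ceil_le_maxOpenCount hlam hb)

end NyquistDensity

section DFT

open scoped FourierTransform
open Real

variable {m : ℕ}

theorem Idx.natCast_ne_zero (k : Idx m) : (m : ℝ) ≠ 0 := by
  have hk := mem_Icc.1 k.2
  exact Nat.cast_ne_zero.2 (by omega)

theorem Idx.eq_of_modEq {k l : Idx m} (h : (k : ℕ) ≡ l [MOD m]) : k = l := by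
  have hk := mem_Icc.1 k.2
  have hl := mem_Icc.1 l.2
  exact Subtype.ext (h.eq_of_abs_lt (by rw [abs_lt]; omega))

theorem sum_Idx_eq_sum_range (f : ℕ → ℂ) : ∑ k : Idx m, f k = ∑ k ∈ range m, f (1 + k) := by
  rw [sum_coe_sort (Icc 1 m), ← Ico_add_one_right_eq_Icc, sum_Ico_eq_sum_range,
    add_tsub_cancel_right]

theorem dft_eq_smul_expMatrix (m : ℕ) :
    dft m =
      (1 / (√m : ℂ)) • expMatrix (fun l : Idx m => -(l : ℤ)) (fun k : Idx m => (k / m : ℝ)) := by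
  ext k l
  rw [dft, Matrix.of_apply, Matrix.smul_apply, expMatrix, Matrix.of_apply, fourierChar_apply,
    smul_eq_mul]
  congr 2
  push_cast
  ring

theorem sin_pi_mul_sub_ne_zero {k l : Idx m} (hkl : k ≠ l) :
    sin (π * ((l - k : ℤ) / m : ℝ)) ≠ 0 := by
  intro h
  obtain ⟨z, hz⟩ := sin_eq_zero_iff.1 h
  have hm := k.natCast_ne_zero
  rw [mul_comm, mul_right_inj' pi_ne_zero, eq_div_iff hm] at hz
  exact hkl (Idx.eq_of_modEq (Int.natCast_modEq_iff.1
    (Int.modEq_iff_dvd.2 ⟨z, by rw [mul_comm]; exact_mod_cast hz.symm⟩)))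

theorem dft_mem_unitaryGroup (m : ℕ) : dft m ∈ Matrix.unitaryGroup (Idx m) ℂ := by
  rw [Matrix.mem_unitaryGroup_iff, Matrix.star_eq_conjTranspose, dft_eq_smul_expMatrix,
    Matrix.conjTranspose_smul, Matrix.smul_mul, Matrix.mul_smul, smul_smul]
  ext k l
  have hm := k.natCast_ne_zero
  have scalar_eq : 1 / (√m : ℂ) * star (1 / (√m : ℂ)) = 1 / m := by
    rw [Complex.star_def, map_div₀, map_one, Complex.conj_ofReal, div_mul_div_comm, one_mul,
      ← Complex.ofReal_mul, mul_self_sqrt (Nat.cast_nonneg m), Complex.ofReal_natCast]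
  rw [scalar_eq, Matrix.smul_apply, expMatrix_mul_conjTranspose_apply, smul_eq_mul]
  rcases eq_or_ne k l with rfl | hkl
  · have : (m : ℂ) ≠ 0 := by exact_mod_cast hm
    simp [this]
  · have sum_eq : ∑ j : Idx m, (𝐞 ((-(j : ℤ) : ℤ) * (k / m - l / m : ℝ)) : ℂ) =
        ∑ j ∈ range m, (𝐞 (((1 : ℤ) + j) * ((l - k : ℤ) / m)) : ℂ) := by
      rw [sum_Idx_eq_sum_range fun j => (𝐞 ((-(j : ℤ) : ℤ) * (k / m - l / m : ℝ)) : ℂ)]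
      refine sum_congr rfl fun j _ => ?_
      congr 2
      push_cast
      ring
    rw [sum_eq, sum_fourierChar_eq_zero 1 (sin_pi_mul_sub_ne_zero hkl)
      (by rw [mul_div_cancel₀ _ hm, fourierChar_intCast]), mul_zero, Matrix.one_apply_ne hkl]

theorem Delta_eq_norm_submatrix (P Q : Finset (Idx m)) {U : Matrix (Idx m) (Idx m) ℂ}
    (hU : U ∈ Matrix.unitaryGroup (Idx m) ℂ) :
    Delta P Q U = ‖U.submatrix (Subtype.val : P → Idx m) (Subtype.val : Q → Idx m)‖ := by
  have truncation_apply (i j : Idx m) : (diagProj P * U * diagProj Q) i j =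
      if i ∈ P ∧ j ∈ Q then U i j else 0 := by
    simp [diagProj, Matrix.diagonal_mul, Matrix.mul_diagonal, ← ite_and, and_comm]
  calc Delta P Q U = ‖diagProj P * U * diagProj Q‖ := by
        rw [Delta, ← Matrix.cstar_norm_def, proj, ← Matrix.mul_assoc, ← Matrix.mul_assoc,
          ← Matrix.star_eq_conjTranspose, CStarRing.norm_mul_mem_unitary _ (Unitary.star_mem hU)]
    _ = ‖(diagProj P * U * diagProj Q).submatrix (Subtype.val : P → Idx m)
        (Subtype.val : Q → Idx m)‖ := by
        rw [norm_submatrix_coe_coe] <;> simp +contextual [truncation_apply]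
    _ = _ := by
        congr 1
        ext i j
        simp [truncation_apply]

theorem exists_dft_submatrix_circInterval_eq (m l n : ℕ) :
    ∃ ν : circInterval m l n → ℤ, ν.Injective ∧
      (∀ q, ν q ∈ Set.Icc (-(l + n) : ℤ) (-(l + n) + (n - 1 : ℕ))) ∧
      (dft m).submatrix id (Subtype.val : circInterval m l n → Idx m) =
        (1 / (√m : ℂ)) • expMatrix ν (fun k : Idx m => (k / m : ℝ)) := by
  have mem_circ (q : circInterval m l n) : ∃ k ∈ Icc 1 n, ((q : Idx m) : ℕ) ≡ l + k [MOD m] :=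
    (mem_filter.1 q.2).2
  choose k hk hq using mem_circ
  refine ⟨fun q => -(l + k q), fun q r hqr => ?_, fun q => ?_, ?_⟩
  · have hqr : k q = k r := by simpa using hqr
    exact Subtype.ext (Idx.eq_of_modEq ((hq q).trans (hqr ▸ (hq r).symm)))
  · have := mem_Icc.1 (hk q)
    constructor <;> push_cast <;> omega
  · rw [dft_eq_smul_expMatrix]
    ext p q
    have hm := p.natCast_ne_zero
    obtain ⟨z, hz⟩ := Int.modEq_iff_dvd.1 (Int.natCast_modEq_iff.2 (hq q))
    have freq_eq : ((-(q : Idx m) : ℤ) : ℝ) * (p / m) =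
        ((-(l + k q) : ℤ) : ℝ) * (p / m) + (z * p : ℤ) := by
      have hz : ((l + k q : ℕ) : ℝ) - (q : Idx m) = m * z := by exact_mod_cast hz
      push_cast at hz ⊢
      field_simp
      linear_combination (p : ℝ) * hz
    simp only [Matrix.submatrix_apply, Matrix.smul_apply, expMatrix, Matrix.of_apply, id]
    rw [freq_eq, fourierChar_add, fourierChar_intCast, mul_one]

theorem norm_dft_submatrix_circInterval_sq_le {P : Finset (Idx m)} {lam : ℝ}
    (hlam : lam ∈ Set.Ioc (0 : ℝ) m) (l n : ℕ) :
    ‖(dft m).submatrix (Subtype.val : P → Idx m) (Subtype.val : circInterval m l n → Idx m)‖ ^ 2 ≤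
      1 / m * (maxOpenCount P lam * ((n - 1 : ℕ) + m / lam)) := by
  obtain ⟨ν, hν, hmem, submatrix_eq⟩ := exists_dft_submatrix_circInterval_eq m l n
  have hm : 0 < m := Nat.cast_pos.1 (hlam.1.trans_le hlam.2)
  have large_sieve := norm_expMatrix_sq_le_of_periodic (periodic_periodization P) hm
    (Nat.ceil_pos.2 hlam.1) (count_periodization_add_ceil_le hlam)
    (p := fun i : P => ((i : Idx m) : ℕ)) (fun i => ⟨i, i.2, rfl⟩)
    (fun i j hij => Subtype.ext (Idx.eq_of_modEq hij)) hν hmem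
  have submatrix_eq' : (dft m).submatrix (Subtype.val : P → Idx m) Subtype.val =
      (1 / (√m : ℂ)) • expMatrix ν (fun i : P => ((i : Idx m) / m : ℝ)) :=
    congrArg (Matrix.submatrix · (Subtype.val : P → Idx m) id) submatrix_eq
  have norm_scalar_sq : ‖(1 / (√m : ℂ))‖ ^ 2 = 1 / m := by
    rw [norm_div, norm_one, Complex.norm_real, norm_of_nonneg (sqrt_nonneg _), div_pow, one_pow,
      sq_sqrt (Nat.cast_nonneg m)]
  have hlam0 := hlam.1
  rw [submatrix_eq', norm_smul, mul_pow, norm_scalar_sq]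
  gcongr
  refine large_sieve.trans ?_
  gcongr
  exact Nat.le_ceil lam

end DFT

end LargeSieve

theorem mainTheorem3 (m : ℕ) (P : Finset (LargeSieve.Idx m)) (l n : ℕ)
    (hl : l ∈ Finset.Icc 1 m) (hn : n ∈ Finset.Icc 1 m)
    (lam : ℝ) (hlam : lam ∈ Set.Ioc (0 : ℝ) m) :
    LargeSieve.Delta P (LargeSieve.circInterval m l n) (LargeSieve.dft m) ≤
      Real.sqrt ((lam * ((n : ℝ) - 1) / m + 1) * LargeSieve.nyquistDensity P lam) := by
  have hlam0 : 0 < lam := hlam.1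
  have hm0 : (0 : ℝ) < m := hlam0.trans_le hlam.2
  refine Real.le_sqrt_of_sq_le ?_
  rw [LargeSieve.Delta_eq_norm_submatrix _ _ (LargeSieve.dft_mem_unitaryGroup m)]
  refine (LargeSieve.norm_dft_submatrix_circInterval_sq_le hlam l n).trans_eq ?_
  rw [LargeSieve.nyquistDensity, Nat.cast_sub (Finset.mem_Icc.1 hn).1, Nat.cast_one]
  field_simp
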